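/- For integers $A,B$ let the Lucas sequences $u_n(A,B)$ and $v_n(A,B)$ ($n\ge 0$) be defined by $u_0=0$, $u_1=1$, $u_{n+1}=Au_n-Bu_{n-1}$ and $v_0=2$, $v_1=A$, $v_{n+1}=Av_n-Bv_{n-1}$ for $n\ge 1$. For rational numbers $x,y$ and a positive integer $m$, write $x\equiv y\pmod m$ if $x-y=m\cdot\frac ab$ with integers $a,b$, where $b\neq 0$ is coprime to $m$. Let $\left(\frac{\cdot}{p}\right)$ be the Jacobi (here Legendre) symbol. **Theorem.** Let $p$ be an odd prime. Then $$\sum_{k=0}^{p-1}\frac{u_k(4,2)}{2^k}\binom{2k}{k}\equiv\left(\frac{-1}{p}\right)-\left(\frac{-2}{p}\right)\pmod{p^2},$$ $$\sum_{k=0}^{p-1}\frac{u_{k+1}(4,2)}{2^k}\binom{2k}{k}\equiv\left(\frac{-1}{p}\right)\pmod{p^2},$$ $$\sum_{k=0}^{(p-1)/2}\frac{u_k(4,2)}{16^k}\binom{2k}{k}\equiv\frac{(-1)^{\lfloor (p-4)/8\rfloor}}{2}\left(1-\left(\frac{2}{p}\right)\right)\pmod{p^2},$$ $$\sum_{k=0}^{(p-1)/2}\frac{v_k(4,2)}{16^k}\binom{2k}{k}\equiv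 2(-1)^{\lfloor p/8\rfloor}\left(\frac{-1}{p}\right)\pmod{p^2}.$$ -/

import Mathlib

/-- The Lucas sequence `u_n(A, B)`: `u_0 = 0`, `u_1 = 1`, `u_{n+1} = A u_n - B u_{n-1}`. -/
def lucasU (A B : ℤ) : ℕ → ℤ
  | 0 => 0
  | 1 => 1
  | n + 2 => A * lucasU A B (n + 1) - B * lucasU A B n

/-- The companion sequence `v_n(A, B)`: `v_0 = 2`, `v_1 = A`, `v_{n+1} = A v_n - B v_{n-1}`. -/
def lucasV (A B : ℤ) : ℕ → ℤ
  | 0 => 2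
  | 1 => A
  | n + 2 => A * lucasV A B (n + 1) - B * lucasV A B n

/-- Congruence of rational numbers modulo `m`: the difference `x - y` is `m` times a fraction
`a / b` whose denominator is coprime to `m`. For integers `x`, `y` this is the usual congruence. -/
def RatModEq (m : ℕ) (x y : ℚ) : Prop :=
  ∃ a b : ℤ, IsCoprime b (m : ℤ) ∧ x - y = (m : ℚ) * ((a : ℚ) / (b : ℚ))

open Finset

/-! ### Binomial sums weighted by a recurrence sequence. -/

section LinearRecurrence

variable {R : Type*} [CommRing R]

/-! In `ℤ√2`, `(2 + √2)^k` has `u_k(4,2)` as `√2`-coefficient and `v_k(4,2)/2` as rational part, so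
each congruence is a component of one in `ℤ√2`. Let `u = octicSeq`, `a = -√2`, `p = 2n + 1`, `F = u
(n+1) - u n`, `G = u (n+1) + u n`, `t = (a+2)^n`. Since `(2 - √2)(2 + √2) = 2`, the sums over `k <
p` become `∑ C(2k,k) (a+2)^(p-1-k)`, which equals `∑ C(2p,p+i) u i`. Modulo `p²` this is `G (2t -
F)` (`sq_dvd_sum_centralBinom_sub`). Modulo `p`, `t ≡ F` because `G` is a unit; squaring gives `2t -
F ≡ t²/F` modulo `p²`, so the scaled sum is `2^(p-1) G/F`. For the half-range sums, `C(2k,k) ≡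
(-16)^k C(n+k,2k)` modulo `p²`, and `∑ C(n+k,2k) (a-2)^k = F` exactly. As `u` has period 8, `F` and
`G` depend only on `p` modulo 16; eight cases finish the proof. -/

theorem choose_two_mul_add_two (n i : ℕ) :
    (2 * (n + 1)).choose (n + 1 + (i + 1)) =
      (2 * n).choose (n + i) + 2 * (2 * n).choose (n + (i + 1)) + (2 * n).choose (n + (i + 2)) := by
  rw [show 2 * (n + 1) = 2 * n + 1 + 1 by ring, show n + 1 + (i + 1) = n + i + 1 + 1 by ring,
    show n + (i + 1) = n + i + 1 by ring, show n + (i + 2) = n + i + 1 + 1 by ring]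
  simp only [Nat.choose_succ_succ (2 * n + 1), Nat.choose_succ_succ (2 * n)]
  ring

/-- Both sides satisfy `S (n+1) = (a+2) S n + C(2n,n)`: on the right, a double Pascal step meets the
recurrence of `u`. -/
theorem sum_centralBinom_mul_pow {a : R} {u : ℕ → R} (h0 : u 0 = 0) (h1 : u 1 = 1)
    (hu : ∀ n, u (n + 2) = a * u (n + 1) - u n) (N : ℕ) :
    ∑ k ∈ range N, ((2 * k).choose k : R) * (a + 2) ^ (N - 1 - k) =
      ∑ i ∈ range N, ((2 * N).choose (N + (i + 1)) : R) * u (i + 1) := by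
  induction N with
  | zero => simp
  | succ n ih =>
    have hL : ∑ k ∈ range (n + 1), ((2 * k).choose k : R) * (a + 2) ^ (n + 1 - 1 - k) =
        (a + 2) * ∑ k ∈ range n, ((2 * k).choose k : R) * (a + 2) ^ (n - 1 - k) +
          (2 * n).choose n := by
      rw [sum_range_succ, mul_sum]
      congr 1
      · refine sum_congr rfl fun k hk => ?_
        have hk' := mem_range.1 hk
        rw [show n + 1 - 1 - k = n - 1 - k + 1 by omega]
        ring
      · simp
    -- Summation by parts up to an arbitrary `M`; the boundary terms vanish at `M = n + 1`.
    have key : ∀ M, ∑ i ∈ range M, ((2 * (n + 1)).choose (n + 1 + (i + 1)) : R) * u (i + 1) =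
        (a + 2) * ∑ i ∈ range M, ((2 * n).choose (n + (i + 1)) : R) * u (i + 1) +
          (2 * n).choose n - (2 * n).choose (n + M) * u (M + 1)
          + (2 * n).choose (n + (M + 1)) * u M := by
      intro M
      induction M with
      | zero => simp [h0, h1]
      | succ M ihM =>
        rw [sum_range_succ, sum_range_succ, ihM, choose_two_mul_add_two, hu M]
        push_cast
        ring
    rw [hL, ih, key (n + 1), sum_range_succ _ n]
    rw [Nat.choose_eq_zero_of_lt (show 2 * n < n + (n + 1) by omega),
      Nat.choose_eq_zero_of_lt (show 2 * n < n + (n + 1 + 1) by omega)]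
    simp

theorem sum_choose_succ_mul_shift (u : ℕ → R) (N j : ℕ) :
    ∑ i ∈ range (N + 2), ((N + 1).choose i : R) * u (i + j) =
      ∑ i ∈ range (N + 1), (N.choose i : R) * u (i + j) +
      ∑ i ∈ range (N + 1), (N.choose i : R) * u (i + (j + 1)) := by
  simpa only [add_assoc, add_comm 1 j] using sum_choose_succ_mul (fun i _ => u (i + j)) N

/-- If `x² = a x - 1` then `(1+x)² = (a+2) x`, hence `(1+x)^(2n+1) = (a+2)^n x^n (1+x)`. -/
theorem sum_choose_mul_of_recurrence {a : R} {u : ℕ → R}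
    (hu : ∀ n, u (n + 2) = a * u (n + 1) - u n) (n j : ℕ) :
    ∑ i ∈ range (2 * n + 2), ((2 * n + 1).choose i : R) * u (i + j) =
      (a + 2) ^ n * (u (n + j + 1) + u (n + j)) := by
  induction n generalizing j with
  | zero => simp [sum_range_succ, add_comm]
  | succ n ih =>
    rw [show 2 * (n + 1) + 2 = (2 * n + 2) + 2 by ring,
      show 2 * (n + 1) + 1 = (2 * n + 2) + 1 by ring,
      sum_choose_succ_mul_shift, sum_choose_succ_mul_shift u (2 * n + 1), sum_choose_succ_mul_shift u (2 * n + 1),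
      ih, ih, ih,
      show n + (j + 1 + 1) + 1 = n + j + 1 + 2 by ring,
      show n + (j + 1 + 1) = n + j + 2 by ring, show n + (j + 1) + 1 = n + j + 2 by ring,
      show n + 1 + j + 1 = n + j + 2 by ring, show n + 1 + j = n + j + 1 by ring,
      show n + (j + 1) = n + j + 1 by ring, hu (n + j + 1), hu (n + j)]
    ring

theorem recurrence_odd_index {a : R} {u : ℕ → R} (h0 : u 0 = 0) (h1 : u 1 = 1)
    (hu : ∀ n, u (n + 2) = a * u (n + 1) - u n) (n : ℕ) :
    u (2 * n + 1) = (u (n + 1) + u n) * (u (n + 1) - u n) := by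
  have add : ∀ n k, u (n + k + 1) = u (n + 1) * u (k + 1) - u n * u k := by
    intro n k
    induction k using Nat.twoStepInduction with
    | zero => simp [h0, h1]
    | one => simp [h1, hu, h0]; ring
    | more k ih1 ih2 =>
      rw [show n + (k + 2) + 1 = n + k + 1 + 2 by ring, hu,
        show n + k + 1 + 1 = n + (k + 1) + 1 by ring, ih1, ih2, hu k,
        show k + 2 + 1 = k + 1 + 2 by ring, hu (k + 1), show k + 1 + 1 = k + 2 by ring, hu k]
      ring
  rw [two_mul, add]
  ring

theorem choose_add_two_mul_second_difference (n k : ℕ) :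
    (n + 2 + (k + 1)).choose (2 * (k + 1)) + (n + (k + 1)).choose (2 * (k + 1)) =
      2 * (n + 1 + (k + 1)).choose (2 * (k + 1)) + (n + 1 + k).choose (2 * k) := by
  rw [show n + 2 + (k + 1) = n + k + 1 + 1 + 1 by ring, show 2 * (k + 1) = 2 * k + 1 + 1 by ring,
    show n + 1 + (k + 1) = n + k + 1 + 1 by ring, show n + (k + 1) = n + k + 1 by ring,
    show n + 1 + k = n + k + 1 by ring]
  simp only [Nat.choose_succ_succ (n + k + 1 + 1), Nat.choose_succ_succ (n + k + 1)]
  ring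

/-- The second difference in `n` of the left side is `a - 2` times its middle value, which is the
recurrence of `u`. -/
theorem sum_choose_add_mul_pow {a : R} {u : ℕ → R} (h0 : u 0 = 0) (h1 : u 1 = 1)
    (hu : ∀ n, u (n + 2) = a * u (n + 1) - u n) (n : ℕ) :
    ∑ k ∈ range (n + 1), ((n + k).choose (2 * k) : R) * (a - 2) ^ k = u (n + 1) - u n := by
  have ext : ∀ n M, n ≤ M → ∑ k ∈ range (n + 1), ((n + k).choose (2 * k) : R) * (a - 2) ^ k =
      ∑ k ∈ range (M + 1), ((n + k).choose (2 * k) : R) * (a - 2) ^ k := by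
    intro n M h
    refine sum_subset (fun x hx => ?_) fun x _ hx => ?_
    · simp only [mem_range] at *; omega
    · simp only [mem_range] at hx
      rw [Nat.choose_eq_zero_of_lt (by omega)]
      simp
  induction n using Nat.twoStepInduction with
  | zero => simp [h0, h1]
  | one => simp [sum_range_succ, h0, h1, hu]; ring
  | more n ih1 ih2 =>
    have hrec : ∑ k ∈ range (n + 2 + 1), ((n + 2 + k).choose (2 * k) : R) * (a - 2) ^ k =
        a * ∑ k ∈ range (n + 1 + 1), ((n + 1 + k).choose (2 * k) : R) * (a - 2) ^ k -
          ∑ k ∈ range (n + 1), ((n + k).choose (2 * k) : R) * (a - 2) ^ k := by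
      have e : a * ∑ k ∈ range (n + 1 + 1), ((n + 1 + k).choose (2 * k) : R) * (a - 2) ^ k =
          2 * ∑ k ∈ range (n + 2 + 1), ((n + 1 + k).choose (2 * k) : R) * (a - 2) ^ k +
          ∑ k ∈ range (n + 2), ((n + 1 + k).choose (2 * k) : R) * (a - 2) ^ (k + 1) := by
        rw [← ext (n + 1) (n + 2) (by omega), mul_sum, mul_sum, ← sum_add_distrib]
        exact sum_congr rfl fun k _ => by ring
      rw [e, ext n (n + 2) (by omega), sum_range_succ' _ (n + 2), sum_range_succ' _ (n + 2),
        sum_range_succ' _ (n + 2)]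
      have : ∑ k ∈ range (n + 2), ((n + 2 + (k + 1)).choose (2 * (k + 1)) : R) * (a - 2) ^ (k + 1)
          = 2 * ∑ k ∈ range (n + 2), ((n + 1 + (k + 1)).choose (2 * (k + 1)) : R) * (a - 2) ^ (k + 1)
          + ∑ k ∈ range (n + 2), ((n + 1 + k).choose (2 * k) : R) * (a - 2) ^ (k + 1)
          - ∑ k ∈ range (n + 2), ((n + (k + 1)).choose (2 * (k + 1)) : R) * (a - 2) ^ (k + 1) := by
        rw [mul_sum, ← sum_add_distrib, ← sum_sub_distrib]
        refine sum_congr rfl fun k _ => ?_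
        have h := congrArg (Nat.cast (R := R)) (choose_add_two_mul_second_difference n k)
        push_cast at h
        linear_combination (a - 2) ^ (k + 1) * h
      rw [this]
      simp
      ring
    rw [hrec, ih1, ih2, hu (n + 1), hu n]
    ring

end LinearRecurrence

/-! ### Binomial coefficients modulo `p²`. -/

section PrimeCongruences

/-- Vandermonde on `p + p`: the two end terms give `2 C(p,i)`, and each inner term is a product of
two multiples of `p`. -/
theorem sq_dvd_choose_two_mul_sub {p : ℕ} (hp : p.Prime) {i : ℕ} (hip : i < p) :
    (p ^ 2 : ℤ) ∣ (2 * p).choose (p + i) - 2 * p.choose i := by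
  have hs : (2 * p).choose (p + i) = (p + p).choose (p - i) := by
    rw [two_mul, ← Nat.choose_symm (by omega)]
    congr 1; omega
  obtain ⟨j, hj⟩ : ∃ j, p - i = j + 1 := ⟨p - i - 1, by omega⟩
  have hc : p.choose i = p.choose (j + 1) := by
    rw [← Nat.choose_symm hip.le, hj]
  rw [hs, hc, hj, Nat.add_choose_eq, Nat.sum_antidiagonal_eq_sum_range_succ_mk, sum_range_succ,
    sum_range_succ']
  have hsum : (p ^ 2 : ℤ) ∣
      ((∑ k ∈ range j, p.choose (k + 1) * p.choose (j + 1 - (k + 1)) : ℕ) : ℤ) := by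
    have : p ^ 2 ∣ ∑ k ∈ range j, p.choose (k + 1) * p.choose (j + 1 - (k + 1)) := by
      refine dvd_sum fun k hk => ?_
      have hk' := mem_range.1 hk
      rw [pow_two]
      exact mul_dvd_mul (hp.dvd_choose_self (by omega) (by omega))
        (hp.dvd_choose_self (by omega) (by omega))
    exact_mod_cast this
  convert hsum using 1
  simp
  ring

/-- Compare ratios of consecutive terms: `4(n+k+1)(n-k) = p² - (2k+1)²`, and the denominators
`2k+1`, `2k+2` stay below `p`. -/
theorem sq_dvd_centralBinom_sub {p n : ℕ} (hp : p.Prime) (hn : p = 2 * n + 1) {k : ℕ}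
    (hk : k ≤ n) :
    (p ^ 2 : ℤ) ∣ (2 * k).choose k - (-16) ^ k * (n + k).choose (2 * k) := by
  induction k with
  | zero => simp
  | succ k ih =>
    obtain ⟨c, hc⟩ := ih (by omega)
    have h1 : ((2 * (k + 1)).choose (k + 1) : ℤ) * (k + 1) = 2 * (2 * k + 1) * (2 * k).choose k := by
      have := Nat.succ_mul_centralBinom_succ k
      simp only [Nat.centralBinom] at this
      have := congrArg (Nat.cast (R := ℤ)) this
      push_cast at this
      linarith
    have h2 : ((n + (k + 1)).choose (2 * (k + 1)) : ℤ) * ((2 * k + 1) * (2 * k + 2)) =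
        (n + k).choose (2 * k) * ((n + k + 1) * (n - k)) := by
      have e1 := Nat.add_one_mul_choose_eq (n + k) (2 * k + 1)
      have e2 := Nat.choose_succ_right_eq (n + k) (2 * k)
      have e1' := congrArg (Nat.cast (R := ℤ)) e1
      have e2' := congrArg (Nat.cast (R := ℤ)) e2
      rw [show n + k - 2 * k = n - k by omega] at e2'
      push_cast [Nat.cast_sub (show k ≤ n by omega)] at e1' e2'
      rw [show n + (k + 1) = n + k + 1 by ring, show 2 * (k + 1) = 2 * k + 1 + 1 by ring]
      linear_combination (-(2 * k + 1 : ℤ)) * e1' + (n + k + 1 : ℤ) * e2'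
    have hcop : IsCoprime ((p : ℤ) ^ 2) ((2 * k + 1) * (2 * k + 2)) := by
      refine IsCoprime.pow_left (IsCoprime.mul_right ?_ ?_)
      · have : Nat.Coprime p (2 * k + 1) :=
          (hp.coprime_iff_not_dvd).2 fun h => by have := Nat.le_of_dvd (by omega) h; omega
        exact_mod_cast Nat.isCoprime_iff_coprime.2 this
      · have : Nat.Coprime p (2 * k + 2) :=
          (hp.coprime_iff_not_dvd).2 fun h => by have := Nat.le_of_dvd (by omega) h; omega
        exact_mod_cast Nat.isCoprime_iff_coprime.2 this
    refine hcop.dvd_of_dvd_mul_left ⟨4 * (2 * k + 1) ^ 2 * c +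
      4 * (-16) ^ k * (n + k).choose (2 * k), ?_⟩
    have hpn : (p : ℤ) = 2 * n + 1 := by exact_mod_cast hn
    rw [hpn] at hc ⊢
    rw [pow_succ]
    linear_combination (2 * (2 * k + 1) : ℤ) * h1 + (16 * (-16) ^ k : ℤ) * h2 +
      (4 * (2 * k + 1) ^ 2 : ℤ) * hc

theorem ratModEq_of_two_pow_mul {p : ℕ} (hp : Odd p) {x : ℚ} {N : ℕ} {X y : ℤ}
    (hx : 2 ^ N * x = X) (h : (p ^ 2 : ℤ) ∣ X - 2 ^ N * y) : RatModEq (p ^ 2) x y := by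
  obtain ⟨c, hc⟩ := h
  refine ⟨c, 2 ^ N, ?_, ?_⟩
  · have : Nat.Coprime (2 ^ N) (p ^ 2) := Nat.Coprime.pow _ _ (Nat.coprime_two_left.2 hp)
    exact_mod_cast Nat.isCoprime_iff_coprime.2 this
  · have hc' := congrArg (Int.cast (R := ℚ)) hc
    push_cast at hc' ⊢
    rw [← mul_div_assoc, eq_div_iff (by positivity)]
    linear_combination hc' + hx

end PrimeCongruences

/-! ### The period-8 sequence and powers of `2 + √2`. -/

section SqrtTwo

/-- The sequence `u_n(-√2, 1)`. -/
def octicSeq : ℕ → ℤ√2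
  | 0 => 0
  | 1 => 1
  | n + 2 => -Zsqrtd.sqrtd * octicSeq (n + 1) - octicSeq n

theorem octicSeq_add_two (n : ℕ) :
    octicSeq (n + 2) = -Zsqrtd.sqrtd * octicSeq (n + 1) - octicSeq n := rfl

theorem octicSeq_add_eight_mul (q r : ℕ) : octicSeq (8 * q + r) = octicSeq r := by
  have hs : (Zsqrtd.sqrtd * Zsqrtd.sqrtd : ℤ√2) = 2 := by ext <;> simp
  -- The roots of `x² + √2 x + 1` are primitive eighth roots of unity, whose fourth power is `-1`.
  have h4 : ∀ n, octicSeq (n + 4) = -octicSeq n := fun n => by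
    rw [octicSeq_add_two, octicSeq_add_two (n + 1), octicSeq_add_two n]
    linear_combination (-Zsqrtd.sqrtd * octicSeq (n + 1) - octicSeq n) * hs
  induction q with
  | zero => simp
  | succ q ih =>
    rw [show 8 * (q + 1) + r = 8 * q + r + 4 + 4 by ring, h4, h4, ih, neg_neg]

theorem two_add_sqrtTwo_pow (k : ℕ) :
    ((2 + Zsqrtd.sqrtd : ℤ√2) ^ k).im = lucasU 4 2 k ∧
      2 * ((2 + Zsqrtd.sqrtd : ℤ√2) ^ k).re = lucasV 4 2 k := by
  induction k using Nat.twoStepInduction with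
  | zero => simp [lucasU, lucasV]
  | one => simp [lucasU, lucasV]
  | more k ih1 ih2 =>
    have : (2 + Zsqrtd.sqrtd : ℤ√2) ^ (k + 2) =
        4 * (2 + Zsqrtd.sqrtd) ^ (k + 1) - 2 * (2 + Zsqrtd.sqrtd) ^ k := by
      have hs : (Zsqrtd.sqrtd * Zsqrtd.sqrtd : ℤ√2) = 2 := by ext <;> simp
      linear_combination (2 + Zsqrtd.sqrtd : ℤ√2) ^ k * hs
    rw [this, lucasU, lucasV, ← ih1.1, ← ih1.2, ← ih2.1, ← ih2.2]
    simp
    ring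

end SqrtTwo

/-! ### Evaluation of the sums modulo `p²`. -/

section LucasSums

theorem sq_dvd_sum_centralBinom_sub {R : Type*} [CommRing R] {a : R} {u : ℕ → R} (h0 : u 0 = 0)
    (h1 : u 1 = 1) (hu : ∀ n, u (n + 2) = a * u (n + 1) - u n) {p n : ℕ} (hp : p.Prime)
    (hn : p = 2 * n + 1) :
    (p ^ 2 : R) ∣ ∑ k ∈ range p, ((2 * k).choose k : R) * (a + 2) ^ (p - 1 - k) -
      (u (n + 1) + u n) * (2 * (a + 2) ^ n - (u (n + 1) - u n)) := by
  have hB := sum_choose_mul_of_recurrence hu n 0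
  rw [sum_range_succ, sum_range_succ', ← hn] at hB
  have hodd := recurrence_odd_index h0 h1 hu n
  rw [sum_centralBinom_mul_pow h0 h1 hu]
  have hS : (p ^ 2 : R) ∣ ∑ i ∈ range (2 * n), (((2 * p).choose (p + (i + 1)) : R) * u (i + 1) -
      2 * ((p.choose (i + 1) : R) * u (i + 1))) := by
    refine dvd_sum fun i hi => ?_
    have hi' := mem_range.1 hi
    obtain ⟨c, hc⟩ := sq_dvd_choose_two_mul_sub hp (show i + 1 < p by omega)
    have hc' := congrArg (Int.cast (R := R)) hc
    push_cast at hc'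
    exact ⟨c * u (i + 1), by linear_combination u (i + 1) * hc'⟩
  rw [sum_sub_distrib, ← mul_sum] at hS
  convert hS using 1
  -- The top term has coefficient `C(2p,2p) = 1`, not `2`; this is the source of the correction `-u
  -- p = -G F`.
  have hsplit : ∑ i ∈ range p, ((2 * p).choose (p + (i + 1)) : R) * u (i + 1) =
      ∑ i ∈ range (2 * n), ((2 * p).choose (p + (i + 1)) : R) * u (i + 1) + u p := by
    conv_lhs => rw [show range p = range (2 * n + 1) by rw [hn], sum_range_succ]
    rw [← hn, ← two_mul]
    simp
  rw [hsplit]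
  simp only [add_zero, Nat.choose_self, Nat.cast_one, one_mul, h0, mul_zero] at hB
  rw [← hn] at hodd
  linear_combination 2 * hB - hodd

/-- Modulo `p` only the top term `u p` of `∑ C(p,i) u i` survives. -/
theorem dvd_pow_mul_sub {R : Type*} [CommRing R] {a : R} {u : ℕ → R} (h0 : u 0 = 0)
    (h1 : u 1 = 1) (hu : ∀ n, u (n + 2) = a * u (n + 1) - u n) {p n : ℕ} (hp : p.Prime)
    (hn : p = 2 * n + 1) :
    (p : R) ∣ (u (n + 1) + u n) * ((a + 2) ^ n - (u (n + 1) - u n)) := by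
  have hB := sum_choose_mul_of_recurrence hu n 0
  rw [sum_range_succ, sum_range_succ', ← hn] at hB
  have hodd := recurrence_odd_index h0 h1 hu n
  have hS : (p : R) ∣ ∑ i ∈ range (2 * n), ((p.choose (i + 1) : R) * u (i + 1)) := by
    refine dvd_sum fun i hi => Dvd.dvd.mul_right ?_ _
    have hi' := mem_range.1 hi
    exact Nat.cast_dvd_cast (hp.dvd_choose_self (by omega) (by omega))
  convert hS using 1
  simp only [add_zero, Nat.choose_self, Nat.cast_one, one_mul, h0, mul_zero] at hB
  rw [← hn] at hodd
  linear_combination hodd - hB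

theorem sq_dvd_sum_centralBinom_mul_two_pow {p n : ℕ} (hp : p.Prime) (hn : p = 2 * n + 1)
    {F' G' : ℤ√2} (hF : (octicSeq (n + 1) - octicSeq n) * F' = 1)
    (hG : (octicSeq (n + 1) + octicSeq n) * G' = 1) :
    (((p ^ 2 : ℤ)) : ℤ√2) ∣
      ∑ k ∈ range p, ((2 * k).choose k : ℤ√2) * 2 ^ (p - 1 - k) * (2 + Zsqrtd.sqrtd) ^ k -
        2 ^ (p - 1) * ((octicSeq (n + 1) + octicSeq n) * F') := by
  have hs : (Zsqrtd.sqrtd * Zsqrtd.sqrtd : ℤ√2) = 2 := by ext <;> simp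
  have hm : (-Zsqrtd.sqrtd + 2) * (2 + Zsqrtd.sqrtd) = (2 : ℤ√2) := by linear_combination -hs
  obtain ⟨c, hc⟩ := sq_dvd_sum_centralBinom_sub (u := octicSeq) rfl rfl octicSeq_add_two hp hn
  obtain ⟨d, hd⟩ := dvd_pow_mul_sub (u := octicSeq) rfl rfl octicSeq_add_two hp hn
  have hsum : ∑ k ∈ range p, ((2 * k).choose k : ℤ√2) * 2 ^ (p - 1 - k) * (2 + Zsqrtd.sqrtd) ^ k =
      (2 + Zsqrtd.sqrtd) ^ (p - 1) *
        ∑ k ∈ range p, ((2 * k).choose k : ℤ√2) * (-Zsqrtd.sqrtd + 2) ^ (p - 1 - k) := by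
    rw [mul_sum]
    refine sum_congr rfl fun k hk => ?_
    have hk' := mem_range.1 hk
    rw [show (2 + Zsqrtd.sqrtd : ℤ√2) ^ (p - 1) =
      (2 + Zsqrtd.sqrtd) ^ (p - 1 - k) * (2 + Zsqrtd.sqrtd) ^ k by
        rw [← pow_add]; congr 1; omega]
    have h2 : (2 : ℤ√2) ^ (p - 1 - k) =
        (-Zsqrtd.sqrtd + 2) ^ (p - 1 - k) * (2 + Zsqrtd.sqrtd) ^ (p - 1 - k) := by
      rw [← mul_pow, hm]
    rw [h2]
    ring
  have h2 : (2 : ℤ√2) ^ (p - 1) = (-Zsqrtd.sqrtd + 2) ^ n * (-Zsqrtd.sqrtd + 2) ^ n *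
      (2 + Zsqrtd.sqrtd) ^ (p - 1) := by
    rw [← hm, mul_pow, ← pow_add]
    congr 2
    omega
  rw [hsum, h2]
  set t : ℤ√2 := (-Zsqrtd.sqrtd + 2) ^ n
  set F := octicSeq (n + 1) - octicSeq n
  set G := octicSeq (n + 1) + octicSeq n
  set T := ∑ k ∈ range p, ((2 * k).choose k : ℤ√2) * (-Zsqrtd.sqrtd + 2) ^ (p - 1 - k)
  set w : ℤ√2 := (2 + Zsqrtd.sqrtd) ^ (p - 1)
  have ht : t - F = p * d * G' := by linear_combination G' * hd - (t - F) * hG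
  -- Uses `F (2t - F) = t² - (t - F)²`, where `t - F` is divisible by `p`.
  have key : T - t * t * (G * F') = p ^ 2 * (c - G * F' * (d * G') ^ 2) := by
    linear_combination hc - G * (2 * t - F) * hF - G * F' * (t - F + p * d * G') * ht
  refine ⟨w * (c - G * F' * (d * G') ^ 2), ?_⟩
  push_cast
  linear_combination w * key

theorem sq_dvd_sum_centralBinom_mul_sixteen_pow {p n : ℕ} (hp : p.Prime) (hn : p = 2 * n + 1) :
    (((p ^ 2 : ℤ)) : ℤ√2) ∣
      ∑ k ∈ range (n + 1), ((2 * k).choose k : ℤ√2) * 16 ^ (n - k) * (2 + Zsqrtd.sqrtd) ^ k -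
        16 ^ n * (octicSeq (n + 1) - octicSeq n) := by
  rw [← sum_choose_add_mul_pow (u := octicSeq) rfl rfl octicSeq_add_two, mul_sum,
    ← sum_sub_distrib]
  refine dvd_sum fun k hk => ?_
  have hk' := mem_range.1 hk
  obtain ⟨c, hc⟩ := sq_dvd_centralBinom_sub hp hn (show k ≤ n by omega)
  have hc' := congrArg (Int.cast (R := ℤ√2)) hc
  push_cast at hc' ⊢
  refine ⟨(c : ℤ√2) * 16 ^ (n - k) * (2 + Zsqrtd.sqrtd : ℤ√2) ^ k, ?_⟩
  conv_lhs => rw [show (16 : ℤ√2) ^ n = 16 ^ (n - k) * 16 ^ k by rw [← pow_add]; congr 1; omega]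
  rw [show (-Zsqrtd.sqrtd - 2 : ℤ√2) = -1 * (2 + Zsqrtd.sqrtd) by ring, mul_pow]
  rw [show (-16 : ℤ√2) = -1 * 16 by ring, mul_pow] at hc'
  linear_combination (16 ^ (n - k) * (2 + Zsqrtd.sqrtd) ^ k : ℤ√2) * hc'

theorem re_sum (s : Finset ℕ) (f : ℕ → ℤ√2) : (∑ i ∈ s, f i).re = ∑ i ∈ s, (f i).re :=
  map_sum ({ toFun := Zsqrtd.re, map_zero' := rfl, map_add' := fun _ _ => rfl } : ℤ√2 →+ ℤ) f s

theorem im_sum (s : Finset ℕ) (f : ℕ → ℤ√2) : (∑ i ∈ s, f i).im = ∑ i ∈ s, (f i).im :=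
  map_sum ({ toFun := Zsqrtd.im, map_zero' := rfl, map_add' := fun _ _ => rfl } : ℤ√2 →+ ℤ) f s

theorem re_intCast_mul (m : ℤ) (z : ℤ√2) : ((m : ℤ√2) * z).re = m * z.re := by simp

theorem im_intCast_mul (m : ℤ) (z : ℤ√2) : ((m : ℤ√2) * z).im = m * z.im := by simp

theorem two_pow_mul_sum (w : ℕ → ℤ) (N e : ℕ) :
    (2 : ℚ) ^ (e * N) * ∑ k ∈ range (N + 1), (w k : ℚ) / (2 ^ e) ^ k * ((2 * k).choose k : ℚ) =
      ((∑ k ∈ range (N + 1), ((2 * k).choose k * (2 ^ e) ^ (N - k) * w k) : ℤ) : ℚ) := by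
  rw [mul_sum]
  push_cast
  refine sum_congr rfl fun k hk => ?_
  have hk' := mem_range.1 hk
  rw [pow_mul, show ((2 : ℚ) ^ e) ^ N = (2 ^ e) ^ (N - k) * (2 ^ e) ^ k by
    rw [← pow_add]; congr 1; omega]
  field_simp

theorem sq_dvd_sum_lucas_mul_two_pow {p n : ℕ} (hp : p.Prime) (hn : p = 2 * n + 1)
    {F' G' c : ℤ√2} (hF : (octicSeq (n + 1) - octicSeq n) * F' = 1)
    (hG : (octicSeq (n + 1) + octicSeq n) * G' = 1)
    (hc : (octicSeq (n + 1) + octicSeq n) * F' = c) :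
    ((p ^ 2 : ℤ) ∣ ∑ k ∈ range p, (2 * k).choose k * 2 ^ (p - 1 - k) * lucasU 4 2 k -
        2 ^ (p - 1) * c.im) ∧
      ((p ^ 2 : ℤ) ∣ ∑ k ∈ range p, (2 * k).choose k * 2 ^ (p - 1 - k) * lucasU 4 2 (k + 1) -
        2 ^ (p - 1) * (2 * c.im + c.re)) := by
  have h := sq_dvd_sum_centralBinom_mul_two_pow hp hn hF hG
  rw [hc] at h
  have him : ∀ z j, (∑ k ∈ range p, ((2 * k).choose k : ℤ√2) * 2 ^ (p - 1 - k) *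
      (2 + Zsqrtd.sqrtd) ^ (k + j) - 2 ^ (p - 1) * z).im =
      ∑ k ∈ range p, (2 * k).choose k * 2 ^ (p - 1 - k) * lucasU 4 2 (k + j) -
        2 ^ (p - 1) * z.im := by
    intro z j
    rw [Zsqrtd.im_sub, im_sum]
    congr 1
    · refine sum_congr rfl fun k _ => ?_
      rw [← (two_add_sqrtTwo_pow (k + j)).1]
      exact_mod_cast im_intCast_mul ((2 * k).choose k * 2 ^ (p - 1 - k)) _
    · exact_mod_cast im_intCast_mul (2 ^ (p - 1)) z
  constructor
  · have := ((Zsqrtd.intCast_dvd _ _).1 h).2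
    have h0 := him c 0
    simp only [add_zero] at h0
    rwa [← h0]
  -- Multiplying by `2 + √2` shifts the Lucas index by one.
  · have := ((Zsqrtd.intCast_dvd _ _).1 (h.mul_right (2 + Zsqrtd.sqrtd))).2
    rw [sub_mul, sum_mul] at this
    rw [show 2 * c.im + c.re = (c * (2 + Zsqrtd.sqrtd)).im by simp; ring, ← him _ 1]
    simpa only [pow_succ, pow_zero, mul_assoc, one_mul] using this

theorem sq_dvd_sum_lucas_mul_sixteen_pow {p n : ℕ} (hp : p.Prime) (hn : p = 2 * n + 1) :
    ((p ^ 2 : ℤ) ∣ ∑ k ∈ range (n + 1), (2 * k).choose k * 16 ^ (n - k) * lucasU 4 2 k -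
        16 ^ n * (octicSeq (n + 1) - octicSeq n).im) ∧
      ((p ^ 2 : ℤ) ∣ ∑ k ∈ range (n + 1), (2 * k).choose k * 16 ^ (n - k) * lucasV 4 2 k -
        16 ^ n * (2 * (octicSeq (n + 1) - octicSeq n).re)) := by
  have h := sq_dvd_sum_centralBinom_mul_sixteen_pow hp hn
  generalize octicSeq (n + 1) - octicSeq n = z at h ⊢
  obtain ⟨hre, him⟩ := (Zsqrtd.intCast_dvd _ _).1 h
  constructor
  · convert him using 1
    rw [Zsqrtd.im_sub, im_sum]
    congr 1
    · refine sum_congr rfl fun k _ => ?_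
      rw [← (two_add_sqrtTwo_pow k).1]
      exact_mod_cast (im_intCast_mul ((2 * k).choose k * 16 ^ (n - k)) _).symm
    · exact_mod_cast (im_intCast_mul (16 ^ n) z).symm
  · have hre2 := hre.mul_left 2
    rw [Zsqrtd.re_sub, re_sum, mul_sub, mul_sum] at hre2
    refine hre2.trans (dvd_of_eq (Eq.symm ?_))
    congr 1
    · refine sum_congr rfl fun k _ => ?_
      rw [← (two_add_sqrtTwo_pow k).2]
      have : (((2 * k).choose k : ℤ√2) * 16 ^ (n - k) * (2 + Zsqrtd.sqrtd) ^ k).re =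
          (2 * k).choose k * 16 ^ (n - k) * ((2 + Zsqrtd.sqrtd : ℤ√2) ^ k).re := by
        exact_mod_cast re_intCast_mul ((2 * k).choose k * 16 ^ (n - k)) _
      rw [this]; ring
    · have : ((16 : ℤ√2) ^ n * z).re = 16 ^ n * z.re := by
        exact_mod_cast re_intCast_mul (16 ^ n) z
      rw [this]; ring

theorem lucas_central_binomial_of_values {p n : ℕ} (hp : p.Prime) (hn : p = 2 * n + 1)
    {F F' G G' c : ℤ√2} (hF : octicSeq (n + 1) - octicSeq n = F)
    (hG : octicSeq (n + 1) + octicSeq n = G) (hFF : F * F' = 1) (hGG : G * G' = 1)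
    (hc : G * F' = c) {y₁ y₂ y₃ y₄ : ℚ} (h₁ : y₁ = c.im) (h₂ : y₂ = (2 * c.im + c.re : ℤ))
    (h₃ : y₃ = F.im) (h₄ : y₄ = (2 * F.re : ℤ)) :
    RatModEq (p ^ 2)
      (∑ k ∈ range p, (lucasU 4 2 k : ℚ) / 2 ^ k * ((2 * k).choose k : ℚ)) y₁ ∧
    RatModEq (p ^ 2)
      (∑ k ∈ range p, (lucasU 4 2 (k + 1) : ℚ) / 2 ^ k * ((2 * k).choose k : ℚ)) y₂ ∧
    RatModEq (p ^ 2)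
      (∑ k ∈ range ((p - 1) / 2 + 1), (lucasU 4 2 k : ℚ) / 16 ^ k * ((2 * k).choose k : ℚ)) y₃ ∧
    RatModEq (p ^ 2)
      (∑ k ∈ range ((p - 1) / 2 + 1), (lucasV 4 2 k : ℚ) / 16 ^ k * ((2 * k).choose k : ℚ)) y₄ := by
  subst hF hG h₁ h₂ h₃ h₄
  have hodd : Odd p := ⟨n, hn⟩
  obtain ⟨d₁, d₂⟩ := sq_dvd_sum_lucas_mul_two_pow hp hn hFF hGG hc
  obtain ⟨d₃, d₄⟩ := sq_dvd_sum_lucas_mul_sixteen_pow hp hn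
  have e16 : (16 : ℤ) ^ n = 2 ^ (4 * n) := by rw [pow_mul]; norm_num
  have hp1 : range p = range (p - 1 + 1) := by rw [Nat.sub_add_cancel hp.one_le]
  have hp2 : range ((p - 1) / 2 + 1) = range (n + 1) := by congr 1; omega
  rw [e16] at d₃ d₄
  rw [hp1] at d₁ d₂ ⊢
  rw [hp2]
  refine ⟨ratModEq_of_two_pow_mul hodd ?_ d₁, ratModEq_of_two_pow_mul hodd ?_ d₂,
    ratModEq_of_two_pow_mul hodd ?_ d₃, ratModEq_of_two_pow_mul hodd ?_ d₄⟩
  · simpa using two_pow_mul_sum (fun k => lucasU 4 2 k) (p - 1) 1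
  · simpa using two_pow_mul_sum (fun k => lucasU 4 2 (k + 1)) (p - 1) 1
  · have := two_pow_mul_sum (fun k => lucasU 4 2 k) n 4
    norm_num at this ⊢
    exact this
  · have := two_pow_mul_sum (fun k => lucasV 4 2 k) n 4
    norm_num at this ⊢
    exact this

theorem neg_one_zpow_two_mul_add (q t : ℤ) : (-1 : ℚ) ^ (2 * q + t) = (-1) ^ t := by
  rw [zpow_add₀ (by norm_num), zpow_mul]
  norm_num

end LucasSums

theorem theorem1p4 (p : ℕ) (hp : p.Prime) (hp2 : p ≠ 2) :
    RatModEq (p ^ 2)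
      (∑ k ∈ Finset.range p, (lucasU 4 2 k : ℚ) / 2 ^ k * ((2 * k).choose k : ℚ))
      ((jacobiSym (-1) p : ℚ) - (jacobiSym (-2) p : ℚ)) ∧
    RatModEq (p ^ 2)
      (∑ k ∈ Finset.range p, (lucasU 4 2 (k + 1) : ℚ) / 2 ^ k * ((2 * k).choose k : ℚ))
      (jacobiSym (-1) p : ℚ) ∧
    RatModEq (p ^ 2)
      (∑ k ∈ Finset.range ((p - 1) / 2 + 1),
        (lucasU 4 2 k : ℚ) / 16 ^ k * ((2 * k).choose k : ℚ))
      ((-1 : ℚ) ^ ⌊((p : ℚ) - 4) / 8⌋ / 2 * (1 - (jacobiSym 2 p : ℚ))) ∧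
    RatModEq (p ^ 2)
      (∑ k ∈ Finset.range ((p - 1) / 2 + 1),
        (lucasV 4 2 k : ℚ) / 16 ^ k * ((2 * k).choose k : ℚ))
      (2 * (-1 : ℚ) ^ ⌊(p : ℚ) / 8⌋ * (jacobiSym (-1) p : ℚ)) := by
  have hodd : Odd p := hp.odd_of_ne_two hp2
  -- The residue `r` fixes the octic values, the Jacobi symbols and the parities of both floors.
  obtain ⟨q, r, hr, hn⟩ : ∃ q r, r < 8 ∧ p = 2 * (8 * q + r) + 1 :=
    ⟨p / 16, p % 16 / 2, by omega, by have := Nat.odd_iff.1 hodd; omega⟩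
  have f₁ : ⌊(p : ℚ) / 8⌋ = (p : ℤ) / 8 := by
    have := Rat.floor_intCast_div_natCast (p : ℤ) 8
    push_cast at this
    exact this
  have f₂ : ⌊((p : ℚ) - 4) / 8⌋ = ((p : ℤ) - 4) / 8 := by
    have := Rat.floor_intCast_div_natCast ((p : ℤ) - 4) 8
    push_cast at this
    exact this
  have m2 : p % 2 = 1 := Nat.odd_iff.1 hodd
  have m4 : p % 4 = (2 * r + 1) % 4 := by omega
  have m8 : p % 8 = (2 * r + 1) % 8 := by omega
  rw [jacobiSym.at_neg_one hodd, jacobiSym.at_two hodd, jacobiSym.at_neg_two hodd, f₁, f₂,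
    ZMod.χ₄_nat_eq_if_mod_four, ZMod.χ₈_nat_eq_if_mod_eight, ZMod.χ₈'_nat_eq_if_mod_eight,
    m2, m4, m8]
  have o₀ := octicSeq_add_eight_mul q r
  have o₁ : octicSeq (8 * q + r + 1) = octicSeq (r + 1) := octicSeq_add_eight_mul q (r + 1)
  interval_cases r
  · rw [show ((p : ℤ) - 4) / 8 = 2 * q + (-1) by omega,
      show (p : ℤ) / 8 = 2 * q + 0 by omega, neg_one_zpow_two_mul_add, neg_one_zpow_two_mul_add]
    refine lucas_central_binomial_of_values hp hn (F := ⟨1, 0⟩) (F' := ⟨1, 0⟩) (G := ⟨1, 0⟩)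
      (G' := ⟨1, 0⟩) (c := ⟨1, 0⟩) (by rw [o₀, o₁]; rfl) (by rw [o₀, o₁]; rfl) rfl rfl rfl
      ?_ ?_ ?_ ?_ <;> norm_num
  · rw [show ((p : ℤ) - 4) / 8 = 2 * q + (-1) by omega,
      show (p : ℤ) / 8 = 2 * q + 0 by omega, neg_one_zpow_two_mul_add, neg_one_zpow_two_mul_add]
    refine lucas_central_binomial_of_values hp hn (F := ⟨-1, -1⟩) (F' := ⟨1, -1⟩) (G := ⟨1, -1⟩)
      (G' := ⟨-1, -1⟩) (c := ⟨3, -2⟩) (by rw [o₀, o₁]; rfl) (by rw [o₀, o₁]; rfl) rfl rfl rfl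
      ?_ ?_ ?_ ?_ <;> norm_num
  · rw [show ((p : ℤ) - 4) / 8 = 2 * q + 0 by omega,
      show (p : ℤ) / 8 = 2 * q + 0 by omega, neg_one_zpow_two_mul_add]
    refine lucas_central_binomial_of_values hp hn (F := ⟨1, 1⟩) (F' := ⟨-1, 1⟩) (G := ⟨1, -1⟩)
      (G' := ⟨-1, -1⟩) (c := ⟨-3, 2⟩) (by rw [o₀, o₁]; rfl) (by rw [o₀, o₁]; rfl) rfl rfl rfl
      ?_ ?_ ?_ ?_ <;> norm_num
  · rw [show ((p : ℤ) - 4) / 8 = 2 * q + 0 by omega,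
      show (p : ℤ) / 8 = 2 * q + 0 by omega, neg_one_zpow_two_mul_add]
    refine lucas_central_binomial_of_values hp hn (F := ⟨-1, 0⟩) (F' := ⟨-1, 0⟩) (G := ⟨1, 0⟩)
      (G' := ⟨1, 0⟩) (c := ⟨-1, 0⟩) (by rw [o₀, o₁]; rfl) (by rw [o₀, o₁]; rfl) rfl rfl rfl
      ?_ ?_ ?_ ?_ <;> norm_num
  · rw [show ((p : ℤ) - 4) / 8 = 2 * q + 0 by omega,
      show (p : ℤ) / 8 = 2 * q + 1 by omega, neg_one_zpow_two_mul_add, neg_one_zpow_two_mul_add]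
    refine lucas_central_binomial_of_values hp hn (F := ⟨-1, 0⟩) (F' := ⟨-1, 0⟩) (G := ⟨-1, 0⟩)
      (G' := ⟨-1, 0⟩) (c := ⟨1, 0⟩) (by rw [o₀, o₁]; rfl) (by rw [o₀, o₁]; rfl) rfl rfl rfl
      ?_ ?_ ?_ ?_ <;> norm_num
  · rw [show ((p : ℤ) - 4) / 8 = 2 * q + 0 by omega,
      show (p : ℤ) / 8 = 2 * q + 1 by omega, neg_one_zpow_two_mul_add, neg_one_zpow_two_mul_add]
    refine lucas_central_binomial_of_values hp hn (F := ⟨1, 1⟩) (F' := ⟨-1, 1⟩) (G := ⟨-1, 1⟩)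
      (G' := ⟨1, 1⟩) (c := ⟨3, -2⟩) (by rw [o₀, o₁]; rfl) (by rw [o₀, o₁]; rfl) rfl rfl rfl
      ?_ ?_ ?_ ?_ <;> norm_num
  · rw [show ((p : ℤ) - 4) / 8 = 2 * q + 1 by omega,
      show (p : ℤ) / 8 = 2 * q + 1 by omega, neg_one_zpow_two_mul_add]
    refine lucas_central_binomial_of_values hp hn (F := ⟨-1, -1⟩) (F' := ⟨1, -1⟩) (G := ⟨-1, 1⟩)
      (G' := ⟨1, 1⟩) (c := ⟨-3, 2⟩) (by rw [o₀, o₁]; rfl) (by rw [o₀, o₁]; rfl) rfl rfl rfl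
      ?_ ?_ ?_ ?_ <;> norm_num
  · rw [show ((p : ℤ) - 4) / 8 = 2 * q + 1 by omega,
      show (p : ℤ) / 8 = 2 * q + 1 by omega, neg_one_zpow_two_mul_add]
    refine lucas_central_binomial_of_values hp hn (F := ⟨1, 0⟩) (F' := ⟨1, 0⟩) (G := ⟨-1, 0⟩)
      (G' := ⟨-1, 0⟩) (c := ⟨-1, 0⟩) (by rw [o₀, o₁]; rfl) (by rw [o₀, o₁]; rfl) rfl rfl rfl
      ?_ ?_ ?_ ?_ <;> norm_num
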